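/- Let $A=\mathbb{C}[\partial_1,\dots,\partial_n]$ be the ring of constant coefficient partial differential operators, identified with $\mathbb{C}[x_1,\dots,x_n]$ by $\partial_i\leftrightarrow x_i$; it acts by differentiation on the space $\mathcal{D}'$ of complex-valued distributions on $\mathbb{R}^n$. For an $A$-submodule $\mathcal{F}\subset\mathcal{D}'$ and a submodule $P\subset A^k$ put $$\mathsf{Ker}_{\mathcal F}(P)=\Big\{f\in\mathcal{F}^k : \textstyle\sum_{j=1}^k p_j(\partial)f_j=0\ \text{ for all } p=(p_1,\dots,p_k)\in P\Big\}.$$ Let $U\subset V\subset\mathbb{R}^n$ with $\overline{U}\subset \mathrm{int}(V)$. A cutoff of $f$ with respect to $U\subset V$ is an $f_c$ that equals $f$ on some neighbourhood of $U$ and equals $0$ on the complement of $V$ (as a distribution, i.e. on the interior of that complement). The pair $U\subset V$ is admissible with respect to $\mathcal{F}$ if every $f\in\mathcal{F}$ has a cutoff in $\mathcal{F}$ with respect to it. The system $\mathsf{Ker}_{\mathcal F}(P)$ is controllable if for every admissible pair $U\subset V$, every $f\in\mathsf{Ker}_{\mathcal F}(P)$ has a cutoff in $\mathsf{Ker}_{\mathcal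 F}(P)$ with respect to it. An injective $A$-module $\mathcal{F}$ is an injective cogenerator if $\mathsf{Hom}_A(M,\mathcal{F})\ne0$ for every nonzero $A$-module $M$. We say that $\mathcal{F}$ has cutoffs if every bounded $V\subset\mathbb{R}^n$ with nonempty interior contains a nonempty $U$, with $\overline{U}\subset\mathrm{int}(V)$, such that $U\subset V$ is admissible with respect to $\mathcal{F}$ (this holds for $\mathcal{D}'$, $\mathcal{C}^\infty$ and $\mathcal{S}'$, for example). **Theorem 2.2** (generalized PBH test). Let $P$ be a submodule of $A^k$, and let $P(\partial)$ be any $\ell\times k$ matrix with entries in $A$ whose $\ell$ rows generate $P$. Let $\mathfrak{i}_\ell(P)$, the cancellation ideal, be the ideal of $A$ generated by the $\ell\times\ell$ minors of $P(\partial)$ (it is $0$ if $\ell>k$), and let $\mathcal{V}(\mathfrak{i}_\ell(P))\subset\mathbb{C}^n$ be its zero set, the cancellation variety. Suppose that $\mathfrak{i}_\ell(P)\neq0$. Then $\ell\le k$, and the following are equivalent: - $A^k/P$ is torsion free; - $\dim\mathcal{V}(\mathfrak{i}_\ell(P))\le n-2$; - $P(x)$ has full row rank $\ell$ for all $x$ in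 the complement of some algebraic subset of $\mathbb{C}^n$ of dimension $\le n-2$; - the Krull dimension of $A/\mathfrak{i}_\ell(P)$ is $\le n-2$. Here the dimension of an algebraic set is the Krull dimension of its coordinate ring, and the empty set and the zero ring have dimension $-\infty$. Hence: (i) if $\mathcal{F}$ is an injective $A$-module and $\dim\mathcal{V}(\mathfrak{i}_\ell(P))\le n-2$, then $\mathsf{Ker}_{\mathcal F}(P)$ is controllable; (ii) if $\mathcal{F}$ is an injective cogenerator that has cutoffs, and $\mathsf{Ker}_{\mathcal F}(P)$ is controllable, then $\dim\mathcal{V}(\mathfrak{i}_\ell(P))\le n-2$. -/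

import Mathlib

namespace PDESystem

open scoped Distributions LineDeriv

noncomputable section

/-- The ring `A = ℂ[∂₁, …, ∂ₙ]` of constant coefficient partial differential operators; the
variable `X i` stands for `∂ᵢ`. The same polynomial ring is used as `ℂ[x₁, …, xₙ]`. -/
abbrev DiffOp (n : ℕ) : Type := MvPolynomial (Fin n) ℂ

/-- The space `𝓓` of real valued test functions on `ℝⁿ`. -/
abbrev Test (n : ℕ) : Type := 𝓓((⊤ : TopologicalSpace.Opens (EuclideanSpace ℝ (Fin n))), ℝ)

/-- The space `𝓓'` of complex valued distributions on `ℝⁿ`: the continuous `ℝ`-linear maps from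
real valued test functions to `ℂ`, equivalently the continuous `ℂ`-linear functionals on complex
valued test functions. -/
def Distr (n : ℕ) : Type := 𝓓'((⊤ : TopologicalSpace.Opens (EuclideanSpace ℝ (Fin n))), ℂ)

instance (n : ℕ) : AddCommGroup (Distr n) :=
  inferInstanceAs
    (AddCommGroup 𝓓'((⊤ : TopologicalSpace.Opens (EuclideanSpace ℝ (Fin n))), ℂ))

instance (n : ℕ) : Module ℂ (Distr n) :=
  inferInstanceAs
    (Module ℂ 𝓓'((⊤ : TopologicalSpace.Opens (EuclideanSpace ℝ (Fin n))), ℂ))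

instance (n : ℕ) : FunLike (Distr n) (Test n) ℂ :=
  inferInstanceAs
    (FunLike 𝓓'((⊤ : TopologicalSpace.Opens (EuclideanSpace ℝ (Fin n))), ℂ) (Test n) ℂ)

instance (n : ℕ) : LineDeriv (EuclideanSpace ℝ (Fin n)) (Distr n) (Distr n) :=
  inferInstanceAs (LineDeriv (EuclideanSpace ℝ (Fin n))
    𝓓'((⊤ : TopologicalSpace.Opens (EuclideanSpace ℝ (Fin n))), ℂ)
    𝓓'((⊤ : TopologicalSpace.Opens (EuclideanSpace ℝ (Fin n))), ℂ))

theorem Distr.ext {n : ℕ} {S T : Distr n} (h : ∀ φ : Test n, S φ = T φ) : S = T :=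
  DFunLike.ext S T h

theorem Distr.add_apply {n : ℕ} (S T : Distr n) (φ : Test n) : (S + T) φ = S φ + T φ := rfl

theorem Distr.smul_apply {n : ℕ} (c : ℂ) (T : Distr n) (φ : Test n) : (c • T) φ = c * T φ := rfl

theorem Distr.lineDeriv_apply {n : ℕ} (v : EuclideanSpace ℝ (Fin n)) (T : Distr n) (φ : Test n) :
    (∂_{v} T) φ = T (-∂_{v} φ) :=
  Distribution.lineDerivOp_apply_apply
    (T : 𝓓'((⊤ : TopologicalSpace.Opens (EuclideanSpace ℝ (Fin n))), ℂ)) φ v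

/-- The distributional derivative `∂ᵢ`, as a `ℂ`-linear endomorphism of `𝓓'`. -/
def partialD (n : ℕ) (i : Fin n) : Module.End ℂ (Distr n) where
  toFun T := ∂_{EuclideanSpace.single i (1 : ℝ)} T
  map_add' S T := by
    apply Distr.ext
    intro φ
    simp only [Distr.lineDeriv_apply, Distr.add_apply]
  map_smul' c T := by
    apply Distr.ext
    intro φ
    simp only [Distr.lineDeriv_apply, Distr.smul_apply, RingHom.id_apply]

theorem testFunction_lineDeriv_comm {n : ℕ} (v w : EuclideanSpace ℝ (Fin n)) (φ : Test n) :
    (∂_{v} (∂_{w} φ : Test n) : Test n) = ∂_{w} (∂_{v} φ : Test n) := by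
  have h1 : ∀ (u : EuclideanSpace ℝ (Fin n)) (ψ : Test n),
      ((∂_{u} ψ : Test n) : EuclideanSpace ℝ (Fin n) → ℝ) = fun x => fderiv ℝ ψ x u := by
    intro u ψ
    funext x
    rw [TestFunction.lineDerivOp_eq_lineDerivCLM ℝ, TestFunction.lineDerivCLM_eq_fderivCLM,
      TestFunction.fderivCLM_apply_of_le ψ (by simp)]
  have hd : Differentiable ℝ (fderiv ℝ φ) := by
    have h2 : ContDiff ℝ 1 (fderiv ℝ φ) :=
      φ.contDiff.fderiv_right (m := 1) (by
        rw [one_add_one_eq_two]; exact WithTop.coe_le_coe.2 (le_top : (2 : ℕ∞) ≤ ⊤))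
    exact h2.differentiable (by simp)
  have h3 : ∀ a b x, (∂_{a} (∂_{b} φ : Test n) : Test n) x =
      fderiv ℝ (fderiv ℝ φ) x a b := by
    intro a b x
    rw [h1, h1]
    simp only
    rw [fderiv_clm_apply (hd x) (differentiableAt_const b)]
    simp
  ext x
  rw [h3, h3]
  have hs : IsSymmSndFDerivAt ℝ φ x :=
    ContDiffAt.isSymmSndFDerivAt (n := ((⊤ : ℕ∞) : WithTop ℕ∞)) φ.contDiff.contDiffAt
      (by simp only [minSmoothness_of_isRCLikeNormedField]
          exact WithTop.coe_le_coe.2 (le_top : (2 : ℕ∞) ≤ ⊤))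
  exact hs v w

theorem partialD_comm (n : ℕ) (i j : Fin n) :
    partialD n i * partialD n j = partialD n j * partialD n i := by
  apply LinearMap.ext
  intro T
  apply Distr.ext
  intro φ
  change (∂_{EuclideanSpace.single i (1 : ℝ)} (∂_{EuclideanSpace.single j (1 : ℝ)} T : Distr n) :
      Distr n) φ =
    (∂_{EuclideanSpace.single j (1 : ℝ)} (∂_{EuclideanSpace.single i (1 : ℝ)} T : Distr n) :
      Distr n) φ
  simp only [Distr.lineDeriv_apply, LineDeriv.lineDerivOp_neg, neg_neg]
  rw [testFunction_lineDeriv_comm]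

theorem partialD_range_comm (n : ℕ) : ∀ a ∈ Set.range (partialD n), ∀ b ∈ Set.range (partialD n),
    a * b = b * a := by
  rintro _ ⟨i, rfl⟩ _ ⟨j, rfl⟩
  exact partialD_comm n i j

open scoped IsMulCommutative in
/-- The ring homomorphism `p ↦ p(∂)` from polynomials to endomorphisms of `𝓓'`: it sends `X i` to
`∂ᵢ` and constants to scalar multiplications. The evaluation takes place in the commutative
subalgebra generated by the `∂ᵢ`. -/
def operator (n : ℕ) : DiffOp n →ₐ[ℂ] Module.End ℂ (Distr n) :=
  have : IsMulCommutative (Algebra.adjoin ℂ (Set.range (partialD n))) :=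
    Algebra.isMulCommutative_adjoin ℂ (partialD_range_comm n)
  (Algebra.adjoin ℂ (Set.range (partialD n))).val.comp
    (MvPolynomial.aeval (R := ℂ) (S₁ := Algebra.adjoin ℂ (Set.range (partialD n)))
      fun i => ⟨partialD n i, Algebra.subset_adjoin ⟨i, rfl⟩⟩)

theorem operator_X (n : ℕ) (i : Fin n) : operator n (MvPolynomial.X i) = partialD n i := by
  simp [operator]

/-- `𝓓'` as an `A`-module: a polynomial `p` acts by the differential operator `p(∂)`. -/
instance distrModule (n : ℕ) : Module (DiffOp n) (Distr n) :=
  Module.compHom (Distr n) (operator n).toRingHom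

theorem X_smul (n : ℕ) (i : Fin n) (T : Distr n) :
    (MvPolynomial.X i : DiffOp n) • T = ∂_{EuclideanSpace.single i (1 : ℝ)} T := by
  change operator n (MvPolynomial.X i) T = _
  rw [operator_X]
  rfl

theorem C_smul (n : ℕ) (c : ℂ) (T : Distr n) : (MvPolynomial.C c : DiffOp n) • T = c • T := by
  change operator n (MvPolynomial.C c) T = _
  rw [← MvPolynomial.algebraMap_eq, AlgHom.commutes]
  rfl

/-- The system `Ker_𝓕(P)`: all `f ∈ 𝓕ᵏ` with `∑ⱼ pⱼ(∂) fⱼ = 0` for all `p ∈ P`. -/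
def ker {n k : ℕ} (F : Submodule (DiffOp n) (Distr n))
    (P : Submodule (DiffOp n) (Fin k → DiffOp n)) : Submodule (DiffOp n) (Fin k → F) where
  carrier := {f | ∀ p ∈ P, ∑ j, p j • f j = 0}
  add_mem' := by
    intro f g hf hg p hp
    simp [smul_add, Finset.sum_add_distrib, hf p hp, hg p hp]
  zero_mem' := by
    intro p _
    simp
  smul_mem' := by
    intro a f hf p hp
    simp only [Pi.smul_apply, smul_comm _ a, ← Finset.smul_sum, hf p hp, smul_zero]

/-- `g` is a cutoff of the distribution `f` with respect to `U ⊆ V`: it equals `f` on some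
neighbourhood of `U`, and equals `0` on the complement of `V` (as a distribution, that is, on the
interior of the complement). -/
def IsCutoff {n : ℕ} (U V : Set (EuclideanSpace ℝ (Fin n))) (f g : Distr n) : Prop :=
  (∃ O, IsOpen O ∧ U ⊆ O ∧ Distribution.IsVanishingOn (g - f) O) ∧
    Distribution.IsVanishingOn g (interior Vᶜ)

/-- The pair `U ⊆ V`, with the closure of `U` contained in the interior of `V`, is admissible with
respect to `𝓕`: every element of `𝓕` has a cutoff in `𝓕` with respect to it. -/
def IsAdmissible {n : ℕ} (F : Submodule (DiffOp n) (Distr n))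
    (U V : Set (EuclideanSpace ℝ (Fin n))) : Prop :=
  closure U ⊆ interior V ∧ ∀ f : F, ∃ g : F, IsCutoff U V (f : Distr n) g

/-- Controllability of a system `B ⊆ 𝓕ᵏ`: for every admissible pair `U ⊆ V`, every `f ∈ B` has a
cutoff in `B` with respect to it. Since there are finitely many components, the neighbourhood of
`U` may be taken componentwise. -/
def IsControllable {n k : ℕ} (F : Submodule (DiffOp n) (Distr n))
    (B : Submodule (DiffOp n) (Fin k → F)) : Prop :=
  ∀ U V : Set (EuclideanSpace ℝ (Fin n)), IsAdmissible F U V →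
    ∀ f ∈ B, ∃ g ∈ B, ∀ j, IsCutoff U V (f j : Distr n) (g j)

/-- The assumption that `𝓕` has enough cutoffs: every bounded `V` with nonempty interior contains
a nonempty `U`, with closure in the interior of `V`, such that the pair is admissible. -/
def HasCutoffs {n : ℕ} (F : Submodule (DiffOp n) (Distr n)) : Prop :=
  ∀ V : Set (EuclideanSpace ℝ (Fin n)), Bornology.IsBounded V → (interior V).Nonempty →
    ∃ U : Set (EuclideanSpace ℝ (Fin n)), U.Nonempty ∧ closure U ⊆ interior V ∧ IsAdmissible F U V

/-- The `A`-module `𝓕` is a cogenerator: `Hom_A(M, 𝓕) ≠ 0` for every nonzero `A`-module `M`. -/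
def IsCogenerator {n : ℕ} (F : Submodule (DiffOp n) (Distr n)) : Prop :=
  ∀ (M : Type) [AddCommGroup M] [Module (DiffOp n) M] [Nontrivial M],
    ∃ φ : M →ₗ[DiffOp n] F, φ ≠ 0

/-- The ideal generated by the maximal minors, that is, the `ℓ × ℓ` minors, of an `ℓ × k` matrix.
It is `0` if `ℓ > k`. -/
def cancellationIdeal {n ℓ k : ℕ} (M : Matrix (Fin ℓ) (Fin k) (DiffOp n)) : Ideal (DiffOp n) :=
  Ideal.span (Set.range fun c : Fin ℓ ↪o Fin k => (M.submatrix id c).det)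

/-- The dimension of an algebraic subset `Z` of `ℂⁿ`: the Krull dimension of its coordinate ring.
It is `⊥` (that is, `-∞`) for the empty set. -/
def varietyDim {n : ℕ} (Z : Set (Fin n → ℂ)) : WithBot ℕ∞ :=
  ringKrullDim (DiffOp n ⧸ MvPolynomial.vanishingIdeal ℂ Z)

/-- The cancellation variety: the common zeros in `ℂⁿ` of the maximal minors. -/
def cancellationVariety {n ℓ k : ℕ} (M : Matrix (Fin ℓ) (Fin k) (DiffOp n)) : Set (Fin n → ℂ) :=
  MvPolynomial.zeroLocus ℂ (cancellationIdeal M)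

end

end PDESystem

/-! Since some maximal minor is nonzero, the rows of `M` are independent and form a basis of `P`. A
torsion class of `Aᵏ/P` then comes from a prime `p`: reduced modulo `p`, the rows become dependent
over the domain `A/(p)` exactly when `p` divides every maximal minor. So torsion freeness means that
no prime divides all of them (`isTorsionFree_quotient_span_row_iff`). As `A` is factorial and its
maximal ideals all have height `n`, a nonzero ideal lies in no principal prime exactly when its
codimension is at least two (`ringKrullDim_quotient_add_two_le_iff`); the Nullstellensatz turns this
into the statements about zero sets.

For (i), torsion freeness makes `P` the kernel of a matrix `N`. Over an injective module every
solution is then the image of a potential under the transpose of `N`, and cutting off the potential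
cuts off the solution.

For (ii), a torsion class has its annihilator in the maximal ideal of a point `c`. A cogenerator
contains a nonzero `e` with `∂ᵢ e = cᵢ e`, and injectivity gives a solution `f` with `p(∂) f = e`,
where `r p ∈ P` and `r ≠ 0`. A cutoff `g` of `f` within the system would give `p(∂) g` of bounded
support, killed by `r`, hence zero by Fourier transform. Then `e` vanishes on a nonempty open set,
so `e = 0`, a contradiction. -/

open scoped Matrix Distributions LineDeriv FourierTransform Manifold ContDiff
open MeasureTheory

/-! ### Maximal minors and linear independence of rows -/

section MaximalMinors

namespace Matrix

/-- A matrix over a field with linearly independent rows has a nonzero maximal minor. -/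
theorem exists_submatrix_det_ne_zero_of_linearIndependent_row {K : Type*} [Field K] {ℓ k : ℕ}
    {M : Matrix (Fin ℓ) (Fin k) K} (h : LinearIndependent K M.row) :
    ∃ c : Fin ℓ ↪o Fin k, (M.submatrix id c).det ≠ 0 := by
  -- A maximal independent set of columns has `ℓ` members, as row and column rank agree; listing
  -- them increasingly gives `c`.
  obtain ⟨κ, a, ha, hspan, hli⟩ := exists_linearIndependent' K M.col
  have : Finite κ := Finite.of_injective a ha
  have : Fintype κ := Fintype.ofFinite κ
  have hcard : Fintype.card κ = ℓ := by
    have h1 := linearIndependent_iff_card_eq_finrank_span.1 hli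
    rw [Set.finrank, hspan, ← Matrix.rank_eq_finrank_span_cols, h.rank_matrix,
      Fintype.card_fin] at h1
    exact h1
  have hs : (Finset.univ.map ⟨a, ha⟩).card = ℓ := by simpa using hcard
  let c := (Finset.univ.map ⟨a, ha⟩).orderEmbOfFin hs
  refine ⟨c, ?_⟩
  have hc : ∀ i, ∃ j, a j = c i := fun i => by
    have h1 := Finset.orderEmbOfFin_mem (Finset.univ.map ⟨a, ha⟩) hs i
    obtain ⟨j, -, hj⟩ := Finset.mem_map.1 h1
    exact ⟨j, hj⟩
  choose b hb using hc
  have hb' : Function.Injective b := fun i j hij => c.injective (by rw [← hb, ← hb, hij])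
  have h2 : LinearIndependent K (M.submatrix id c).col := by
    have h3 : (M.submatrix id c).col = (M.col ∘ a) ∘ b := by
      funext i j
      change M j (c i) = M j (a (b i))
      rw [hb]
    rw [h3]
    exact hli.comp b hb'
  exact ((Matrix.isUnit_iff_isUnit_det _).1
    (Matrix.linearIndependent_cols_iff_isUnit.1 h2)).ne_zero

/-- If all maximal minors of a matrix over a domain vanish, its rows are linearly dependent. -/
theorem exists_vecMul_eq_zero_of_submatrix_det_eq_zero {R : Type*} [CommRing R] [IsDomain R]
    {ℓ k : ℕ} {M : Matrix (Fin ℓ) (Fin k) R}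
    (h : ∀ c : Fin ℓ ↪o Fin k, (M.submatrix id c).det = 0) :
    ∃ a : Fin ℓ → R, a ≠ 0 ∧ a ᵥ* M = 0 := by
  let K := FractionRing R
  have h1 : ¬ LinearIndependent K (M.map (algebraMap R K)).row := by
    intro hli
    obtain ⟨c, hc⟩ := exists_submatrix_det_ne_zero_of_linearIndependent_row hli
    apply hc
    rw [Matrix.submatrix_map, ← RingHom.mapMatrix_apply, ← RingHom.map_det, h c, map_zero]
  rw [← LinearIndependent.iff_fractionRing R K, Fintype.linearIndependent_iff] at h1
  push Not at h1
  obtain ⟨a, ha, i, hi⟩ := h1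
  refine ⟨a, fun h0 => hi (by simp [h0]), ?_⟩
  funext j
  apply IsFractionRing.injective R K
  have h2 := congrFun ha j
  simpa [Matrix.vecMul, dotProduct, Matrix.row, Algebra.smul_def] using h2

/-- A matrix over a field has full row rank if and only if some maximal minor is nonzero. -/
theorem rank_eq_iff_exists_submatrix_det_ne_zero {K : Type*} [Field K] {ℓ k : ℕ}
    {M : Matrix (Fin ℓ) (Fin k) K} :
    M.rank = ℓ ↔ ∃ c : Fin ℓ ↪o Fin k, (M.submatrix id c).det ≠ 0 := by
  constructor
  · intro h
    apply exists_submatrix_det_ne_zero_of_linearIndependent_row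
    rw [linearIndependent_iff_card_eq_finrank_span, Set.finrank, Fintype.card_fin]
    rw [Matrix.rank_eq_finrank_span_row] at h
    exact h.symm
  · rintro ⟨c, hc⟩
    apply le_antisymm (by simpa using M.rank_le_card_height)
    calc ℓ = (M.submatrix id c).rank := by
          rw [Matrix.rank_of_det_ne_zero hc, Fintype.card_fin]
      _ ≤ M.rank := Matrix.rank_submatrix_le M id c

end Matrix

end MaximalMinors

/-! ### Torsion in the cokernel of a matrix -/

section TorsionFree

variable {R : Type*} [CommRing R] [IsDomain R] {ℓ k : ℕ}

theorem Submodule.mem_span_range_row_iff {S : Type*} [CommRing S]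
    {M : Matrix (Fin ℓ) (Fin k) S} {v : Fin k → S} :
    v ∈ Submodule.span S (Set.range fun i => M i) ↔ ∃ a : Fin ℓ → S, a ᵥ* M = v := by
  rw [Submodule.mem_span_range_iff_exists_fun]
  simp only [Matrix.vecMul_eq_sum]

theorem Submodule.isTorsionFree_quotient_iff {M : Type*} [AddCommGroup M] [Module R M]
    (P : Submodule R M) :
    Module.IsTorsionFree R (M ⧸ P) ↔ ∀ r : R, r ≠ 0 → ∀ v : M, r • v ∈ P → v ∈ P := by
  constructor
  · intro h r hr v hv
    rw [← Submodule.Quotient.mk_eq_zero] at hv ⊢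
    rw [Submodule.Quotient.mk_smul] at hv
    exact (smul_eq_zero_iff_right hr).1 hv
  · intro h
    refine ⟨fun r hr x y hxy => ?_⟩
    induction x using Submodule.Quotient.induction_on with | _ x
    induction y using Submodule.Quotient.induction_on with | _ y
    simp only [← Submodule.Quotient.mk_smul] at hxy
    rw [Submodule.Quotient.eq, ← smul_sub] at hxy
    exact (Submodule.Quotient.eq P).2 (h r hr.ne_zero _ hxy)

/-- The row space of a matrix over a factorial domain with a nonzero maximal minor has torsion free
cokernel if and only if the maximal minors have no common prime factor. -/
theorem isTorsionFree_quotient_span_row_iff [UniqueFactorizationMonoid R]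
    {M : Matrix (Fin ℓ) (Fin k) R}
    (hM : ∃ c : Fin ℓ ↪o Fin k, (M.submatrix id c).det ≠ 0) :
    Module.IsTorsionFree R ((Fin k → R) ⧸ Submodule.span R (Set.range fun i => M i)) ↔
      ∀ p : R, Prime p → ∃ c : Fin ℓ ↪o Fin k, ¬ p ∣ (M.submatrix id c).det := by
  have hinj : ∀ a : Fin ℓ → R, a ᵥ* M = 0 → a = 0 := by
    obtain ⟨c, hc⟩ := hM
    intro a ha
    refine Matrix.eq_zero_of_vecMul_eq_zero hc ?_
    funext j
    simpa [Matrix.vecMul, dotProduct] using congrFun ha (c j)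
  rw [Submodule.isTorsionFree_quotient_iff]
  constructor
  · intro h p hp
    by_contra! hdvd
    have : (Ideal.span {p}).IsPrime := (Ideal.span_singleton_prime hp.ne_zero).2 hp
    -- A relation between the rows modulo `p` lifts to `b ᵥ* M = p • v`, so the class of `v` is
    -- killed by `p`.
    obtain ⟨a, ha0, ha⟩ := Matrix.exists_vecMul_eq_zero_of_submatrix_det_eq_zero
      (M := M.map (Ideal.Quotient.mk (Ideal.span {p}))) (fun c => by
        rw [Matrix.submatrix_map, ← RingHom.mapMatrix_apply, ← RingHom.map_det,
          Ideal.Quotient.eq_zero_iff_dvd]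
        exact hdvd c)
    choose b hb using fun i => Ideal.Quotient.mk_surjective (a i)
    have h1 : ∀ j, p ∣ (b ᵥ* M) j := by
      intro j
      rw [← Ideal.Quotient.eq_zero_iff_dvd]
      have := congrFun ha j
      simpa [Matrix.vecMul, dotProduct, hb] using this
    choose v hv using h1
    have h2 : v ∈ Submodule.span R (Set.range fun i => M i) :=
      h p hp.ne_zero v (Submodule.mem_span_range_row_iff.2 ⟨b, by funext j; simp [hv]⟩)
    obtain ⟨e, he⟩ := Submodule.mem_span_range_row_iff.1 h2
    -- Independence of the rows forces `b = p • e`, although `b` is nonzero modulo `p`.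
    have h3 : b - p • e = 0 := hinj _ (by
      rw [Matrix.sub_vecMul, Matrix.smul_vecMul, he]
      funext j
      simp [hv])
    apply ha0
    funext i
    rw [← hb i, sub_eq_zero.1 h3, Pi.zero_apply, Ideal.Quotient.eq_zero_iff_dvd]
    exact ⟨e i, rfl⟩
  · intro h r hr
    induction r using UniqueFactorizationMonoid.induction_on_prime with
    | h₁ => exact absurd rfl hr
    | h₂ u hu =>
      intro v hv
      exact (Submodule.smul_mem_iff_of_isUnit _ hu).1 hv
    | h₃ r p hr0 hp ih =>
      intro v hv
      rw [mul_smul] at hv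
      refine ih hr0 v ?_
      obtain ⟨a, ha⟩ := Submodule.mem_span_range_row_iff.1 hv
      obtain ⟨c, hc⟩ := h p hp
      have : (Ideal.span {p}).IsPrime := (Ideal.span_singleton_prime hp.ne_zero).2 hp
      -- Modulo `p` the relation reads `a ᵥ* M = 0`. A minor that is nonzero modulo `p` forces `p ∣
      -- a`, so one factor `p` cancels.
      have h4 : (fun i => Ideal.Quotient.mk (Ideal.span {p}) (a i)) = 0 := by
        refine Matrix.eq_zero_of_vecMul_eq_zero
          (M := (M.submatrix id c).map (Ideal.Quotient.mk (Ideal.span {p}))) ?_ ?_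
        · rw [← RingHom.mapMatrix_apply, ← RingHom.map_det, Ne, Ideal.Quotient.eq_zero_iff_dvd]
          exact hc
        · funext j
          have h5 := congrArg (Ideal.Quotient.mk (Ideal.span {p})) (congrFun ha (c j))
          have h6 : Ideal.Quotient.mk (Ideal.span {p}) p = 0 := by
            rw [Ideal.Quotient.eq_zero_iff_dvd]
          simpa [Matrix.vecMul, dotProduct, h6] using h5
      have h7 : ∀ i, p ∣ a i := fun i => by
        rw [← Ideal.Quotient.eq_zero_iff_dvd]
        exact congrFun h4 i
      choose b hb using h7
      refine Submodule.mem_span_range_row_iff.2 ⟨b, ?_⟩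
      have h8 : p • (b ᵥ* M) = p • (r • v) := by
        rw [← ha, ← Matrix.smul_vecMul]
        congr 1
        funext i
        simp [hb]
      exact smul_right_injective _ hp.ne_zero h8

/-- If the row space of a matrix with a nonzero maximal minor has torsion free cokernel, it is the
kernel of an endomorphism. -/
theorem exists_ker_eq_span_row {M : Matrix (Fin ℓ) (Fin k) R}
    (hM : ∃ c : Fin ℓ ↪o Fin k, (M.submatrix id c).det ≠ 0)
    (h : Module.IsTorsionFree R ((Fin k → R) ⧸ Submodule.span R (Set.range fun i => M i))) :
    ∃ N : (Fin k → R) →ₗ[R] (Fin k → R),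
      LinearMap.ker N = Submodule.span R (Set.range fun i => M i) := by
  rw [Submodule.isTorsionFree_quotient_iff] at h
  obtain ⟨c, hc⟩ := hM
  let B := M.submatrix id c
  -- By Cramer's rule `v = a ᵥ* M` satisfies `det B • v = ((v ∘ c) ᵥ* adj B) ᵥ* M`. Conversely, this
  -- equation puts `det B • v` in the row space, and torsion freeness removes the factor.
  refine ⟨B.det • LinearMap.id - (Matrix.vecMulLinear M).comp
    ((Matrix.vecMulLinear B.adjugate).comp (LinearMap.funLeft R R c)), le_antisymm ?_ ?_⟩
  · intro v hv
    refine h B.det hc v (Submodule.mem_span_range_row_iff.2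
      ⟨(v ∘ c) ᵥ* B.adjugate, ?_⟩)
    rw [LinearMap.mem_ker] at hv
    exact (sub_eq_zero.1 hv).symm
  · intro v hv
    obtain ⟨a, rfl⟩ := Submodule.mem_span_range_row_iff.1 hv
    rw [LinearMap.mem_ker]
    have h1 : (a ᵥ* M) ∘ c = a ᵥ* B := rfl
    change B.det • (a ᵥ* M) - (((a ᵥ* M) ∘ c) ᵥ* B.adjugate) ᵥ* M = 0
    rw [h1, Matrix.vecMul_vecMul a B, Matrix.mul_adjugate, Matrix.vecMul_smul, Matrix.vecMul_one,
      Matrix.smul_vecMul, sub_self]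

end TorsionFree

/-! ### Ideals of codimension two in polynomial rings -/

section KrullDimension

theorem WithBot.exists_eq_natCast_of_le_natCast {d : WithBot ℕ∞} {N : ℕ} (h0 : 0 ≤ d)
    (hN : d ≤ N) : ∃ m : ℕ, d = m := by
  induction d with
  | bot => simp at h0
  | coe d =>
    induction d with
    | top => exact absurd (WithBot.coe_le_coe.1 hN) (by simp)
    | coe m => exact ⟨m, rfl⟩

/-- All maximal ideals of a polynomial ring over an algebraically closed field have full height. -/
theorem MvPolynomial.card_le_height_of_isMaximal {K σ : Type*} [Field K] [IsAlgClosed K] [Finite σ]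
    (m : Ideal (MvPolynomial σ K)) [m.IsMaximal] : (Nat.card σ : ℕ∞) ≤ m.height := by
  -- Some maximal ideal has full height, as otherwise the Krull dimension would be less than the
  -- number of variables.
  obtain ⟨m', hm', hle⟩ : ∃ m' : Ideal (MvPolynomial σ K), m'.IsMaximal ∧
      (Nat.card σ : ℕ∞) ≤ m'.height := by
    by_contra! hlt
    have hdim := MvPolynomial.ringKrullDim_of_isNoetherianRing (R := K) (ι := σ)
    rw [ringKrullDim_eq_zero_of_field, zero_add] at hdim
    rcases Nat.eq_zero_or_pos (Nat.card σ) with h0 | hpos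
    · exact absurd (hlt m inferInstance) (by simp [h0])
    · have h1 : ringKrullDim (MvPolynomial σ K) ≤ ((Nat.card σ - 1 : ℕ) : WithBot ℕ∞) := by
        rw [ringKrullDim_le_iff_isMaximal_height_le]
        intro I hI
        have h2 := hlt I hI
        have h3 : I.height ≤ ((Nat.card σ - 1 : ℕ) : ℕ∞) := by
          apply Order.le_of_lt_add_one
          calc I.height < (Nat.card σ : ℕ∞) := h2
            _ = ((Nat.card σ - 1 : ℕ) : ℕ∞) + 1 := by
                exact_mod_cast (Nat.sub_add_cancel hpos).symm
        exact WithBot.coe_le_coe.2 h3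
      rw [hdim] at h1
      have h4 : Nat.card σ ≤ Nat.card σ - 1 := by exact_mod_cast h1
      omega
  obtain ⟨x, rfl⟩ := MvPolynomial.isMaximal_iff_eq_vanishingIdeal_singleton.1 hm'
  obtain ⟨y, rfl⟩ := MvPolynomial.isMaximal_iff_eq_vanishingIdeal_singleton.1
    (inferInstance : m.IsMaximal)
  -- By the Nullstellensatz maximal ideals are points, and a translation carries one point to any
  -- other.
  let e : MvPolynomial σ K ≃ₐ[K] MvPolynomial σ K := AlgEquiv.ofAlgHom
    (MvPolynomial.aeval fun i => MvPolynomial.X i + MvPolynomial.C (x i - y i))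
    (MvPolynomial.aeval fun i => MvPolynomial.X i - MvPolynomial.C (x i - y i))
    (by ext i; simp) (by ext i; simp)
  have he : (MvPolynomial.vanishingIdeal K {x}).comap e.symm.toRingEquiv =
      MvPolynomial.vanishingIdeal K {y} := by
    ext p
    have h1 : (MvPolynomial.aeval x).comp e.symm.toAlgHom = MvPolynomial.aeval y := by
      ext i
      simp [e]
    have h2 := AlgHom.congr_fun h1 p
    simp only [Ideal.mem_comap, MvPolynomial.mem_vanishingIdeal_iff, Set.mem_singleton_iff,
      forall_eq]
    rw [← h2]
    rfl
  rw [← he, RingEquiv.height_comap]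
  exact hle

/-- A nonzero ideal of a polynomial ring over an algebraically closed field has codimension at least
two if and only if it is not contained in a principal prime ideal. -/
theorem MvPolynomial.ringKrullDim_quotient_add_two_le_iff {K σ : Type*} [Field K] [IsAlgClosed K]
    [Finite σ] {I : Ideal (MvPolynomial σ K)} (hI : I ≠ ⊥) :
    ringKrullDim (MvPolynomial σ K ⧸ I) + 2 ≤ (Nat.card σ : WithBot ℕ∞) ↔
      ∀ p : MvPolynomial σ K, Prime p → ¬ I ≤ Ideal.span {p} := by
  have hdim := MvPolynomial.ringKrullDim_of_isNoetherianRing (R := K) (ι := σ)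
  rw [ringKrullDim_eq_zero_of_field, zero_add] at hdim
  constructor
  · intro h p hp hle
    have h1 : ringKrullDim (MvPolynomial σ K ⧸ Ideal.span {p}) ≤
        ringKrullDim (MvPolynomial σ K ⧸ I) :=
      ringKrullDim_le_of_surjective _ (Ideal.Quotient.factor_surjective hle)
    -- A maximal ideal containing `p` has full height, and dividing by one element lowers height by
    -- at most one, so the quotient by `p` has codimension at most one.
    obtain ⟨m, hm, hpm⟩ := Ideal.exists_le_maximal (Ideal.span {p})
      (by rw [Ne, Ideal.span_singleton_eq_top]; exact hp.not_isUnit)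
    have h2 := Ideal.height_le_ringKrullDim_quotient_add_one
      (hpm (Ideal.mem_span_singleton_self p))
    have h3 : (Nat.card σ : WithBot ℕ∞) ≤ m.height := by
      exact_mod_cast MvPolynomial.card_le_height_of_isMaximal m
    have h4 : ringKrullDim (MvPolynomial σ K ⧸ I) + 2 ≤
        ringKrullDim (MvPolynomial σ K ⧸ I) + 1 :=
      h.trans (h3.trans (h2.trans (by gcongr)))
    have h5 : (0 : WithBot ℕ∞) ≤ ringKrullDim (MvPolynomial σ K ⧸ I) := by
      refine le_trans ?_ h1
      have : Nontrivial (MvPolynomial σ K ⧸ Ideal.span {p}) :=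
        Ideal.Quotient.nontrivial_iff.2 (by
          rw [Ne, Ideal.span_singleton_eq_top]; exact hp.not_isUnit)
      exact ringKrullDim_nonneg_of_nontrivial
    have h6 : ringKrullDim (MvPolynomial σ K ⧸ I) ≤ (Nat.card σ : WithBot ℕ∞) :=
      (ringKrullDim_quotient_le I).trans hdim.le
    -- The inequality `d + 2 ≤ d + 1` is absurd only for a finite `d`, hence the exclusion of `⊥`
    -- and `⊤`.
    obtain ⟨d, hd⟩ := WithBot.exists_eq_natCast_of_le_natCast h5 h6
    rw [hd] at h4
    have : d + 2 ≤ d + 1 := by exact_mod_cast h4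
    omega
  · intro h
    cases isEmpty_or_nonempty (PrimeSpectrum.zeroLocus (I : Set (MvPolynomial σ K))) with
    | inl hemp =>
      rw [ringKrullDim_quotient, Order.krullDim_eq_bot, WithBot.bot_add]
      exact bot_le
    | inr hnon =>
      -- A chain of primes over `I` extends downwards by two: its lowest member contains a prime
      -- element `p`, the inclusion of `(p)` is strict because `I` is not inside `(p)`, and `⊥` lies
      -- strictly below `(p)`.
      have key : ∀ s : LTSeries (PrimeSpectrum.zeroLocus (I : Set (MvPolynomial σ K))),
          s.length + 2 ≤ Nat.card σ := by
        intro s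
        have hIs : I ≤ s.head.1.asIdeal := s.head.2
        have hne : s.head.1.asIdeal ≠ ⊥ := fun h0 => hI (le_bot_iff.1 (h0 ▸ hIs))
        obtain ⟨p, hps, hp⟩ := s.head.1.2.exists_mem_prime_of_ne_bot hne
        let q : PrimeSpectrum (MvPolynomial σ K) :=
          ⟨Ideal.span {p}, (Ideal.span_singleton_prime hp.ne_zero).2 hp⟩
        have hq : q < s.head.1 := by
          refine lt_of_le_of_ne ((Ideal.span_singleton_le_iff_mem _).2 hps) ?_
          intro heq
          exact h p hp (hIs.trans (le_of_eq (congrArg PrimeSpectrum.asIdeal heq).symm))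
        have hb : (⊥ : PrimeSpectrum (MvPolynomial σ K)) < q := by
          refine lt_of_le_of_ne bot_le ?_
          intro heq
          have := congrArg PrimeSpectrum.asIdeal heq
          have hz : p ∈ (⊥ : Ideal (MvPolynomial σ K)) := by
            have h9 : p ∈ q.asIdeal := Ideal.mem_span_singleton_self p
            rw [← heq] at h9
            exact h9
          exact hp.ne_zero hz
        let t : LTSeries (PrimeSpectrum (MvPolynomial σ K)) := s.map Subtype.val (fun _ _ h => h)
        have ht : t.head = s.head.1 := rfl
        let t1 := t.cons q (by rw [ht]; exact hq)
        let t2 := t1.cons ⊥ (by simpa [t1] using hb)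
        have h2 : (t2.length : WithBot ℕ∞) ≤ ringKrullDim (MvPolynomial σ K) :=
          Order.le_krullDim_iff.2 ⟨t2, rfl⟩
        rw [hdim] at h2
        have h3 : t2.length = s.length + 2 := by
          have h4 : t.length = s.length := rfl
          simp [t2, t1, h4, add_assoc]
        rw [← h3]
        exact_mod_cast h2
      have h0 : (0 : WithBot ℕ∞) ≤ ringKrullDim (MvPolynomial σ K ⧸ I) := by
        rw [ringKrullDim_quotient]
        exact Order.krullDim_nonneg
      obtain ⟨d, hd⟩ := WithBot.exists_eq_natCast_of_le_natCast h0
        ((ringKrullDim_quotient_le I).trans hdim.le)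
      rw [hd]
      rw [ringKrullDim_quotient] at hd
      obtain ⟨s, hs⟩ := Order.le_krullDim_iff.1 hd.ge
      have := key s
      rw [hs] at this
      exact_mod_cast this

theorem ringKrullDim_quotient_radical {R : Type*} [CommRing R] (I : Ideal R) :
    ringKrullDim (R ⧸ I.radical) = ringKrullDim (R ⧸ I) := by
  rw [ringKrullDim_quotient, ringKrullDim_quotient, PrimeSpectrum.zeroLocus_radical]

end KrullDimension

/-! ### Dimension of the cancellation variety -/

namespace PDESystem

theorem varietyDim_zeroLocus {n : ℕ} (I : Ideal (DiffOp n)) :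
    varietyDim (MvPolynomial.zeroLocus ℂ I) = ringKrullDim (DiffOp n ⧸ I) := by
  rw [varietyDim, MvPolynomial.vanishingIdeal_zeroLocus_eq_radical,
    ringKrullDim_quotient_radical]

theorem varietyDim_mono {n : ℕ} {Y Z : Set (Fin n → ℂ)} (h : Y ⊆ Z) :
    varietyDim Y ≤ varietyDim Z :=
  ringKrullDim_le_of_surjective _
    (Ideal.Quotient.factor_surjective (MvPolynomial.vanishingIdeal_anti_mono h))

theorem mem_cancellationVariety {n ℓ k : ℕ} {M : Matrix (Fin ℓ) (Fin k) (DiffOp n)}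
    {x : Fin n → ℂ} :
    x ∈ cancellationVariety M ↔ (M.map (MvPolynomial.eval x)).rank ≠ ℓ := by
  rw [Ne, Matrix.rank_eq_iff_exists_submatrix_det_ne_zero, cancellationVariety,
    cancellationIdeal, MvPolynomial.zeroLocus_span]
  simp only [Set.mem_ofPred_eq, Set.forall_mem_range, not_exists, not_not, Matrix.submatrix_map,
    ← RingHom.mapMatrix_apply, ← RingHom.map_det]
  rfl

theorem exists_submatrix_det_ne_zero {n ℓ k : ℕ} {M : Matrix (Fin ℓ) (Fin k) (DiffOp n)}
    (h : cancellationIdeal M ≠ ⊥) : ∃ c : Fin ℓ ↪o Fin k, (M.submatrix id c).det ≠ 0 := by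
  by_contra! h0
  apply h
  rw [cancellationIdeal, Ideal.span_eq_bot]
  rintro _ ⟨c, rfl⟩
  exact h0 c

/-- Both sides say that no prime divides all maximal minors. -/
theorem isTorsionFree_iff_ringKrullDim {n ℓ k : ℕ} {M : Matrix (Fin ℓ) (Fin k) (DiffOp n)}
    (h : cancellationIdeal M ≠ ⊥) :
    Module.IsTorsionFree (DiffOp n)
        ((Fin k → DiffOp n) ⧸ Submodule.span (DiffOp n) (Set.range fun i => M i)) ↔
      ringKrullDim (DiffOp n ⧸ cancellationIdeal M) + 2 ≤ (n : WithBot ℕ∞) := by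
  have h1 := MvPolynomial.ringKrullDim_quotient_add_two_le_iff h
  rw [Nat.card_fin] at h1
  rw [h1, isTorsionFree_quotient_span_row_iff (exists_submatrix_det_ne_zero h)]
  refine forall₂_congr fun p _ => ?_
  rw [cancellationIdeal, Ideal.span_le, Set.range_subset_iff]
  push Not
  simp [Ideal.mem_span_singleton]

end PDESystem

/-! ### Uniform Taylor estimates for translations -/

section TaylorRemainder

universe u

variable {E F : Type*} [NormedAddCommGroup E] [NormedSpace ℝ E] [NormedAddCommGroup F]
  [NormedSpace ℝ F]

/-- The first order Taylor remainder of the translation of `f` by `h`. -/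
noncomputable def translationRemainder (f : E → F) (h : E) (x : E) : F :=
  f (x - h) - f x + fderiv ℝ f x h

/-- Symmetry of the second derivative identifies the derivative of `x ↦ f'(x) h` with `f''(x) h`.
Estimates for the remainder thus pass to its derivatives. -/
theorem fderiv_translationRemainder {f : E → F} (hf : ContDiff ℝ (⊤ : ℕ∞) f) (h : E) :
    fderiv ℝ (translationRemainder f h) = translationRemainder (fderiv ℝ f) h := by
  have hd : Differentiable ℝ f := hf.differentiable (by simp)
  have hd' : Differentiable ℝ (fderiv ℝ f) :=
    (hf.fderiv_right (m := 1) (by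
      rw [one_add_one_eq_two]; exact WithTop.coe_le_coe.2 (le_top : (2 : ℕ∞) ≤ ⊤))).differentiable
      (by simp)
  funext x
  have h1 : HasFDerivAt (fun x => f (x - h)) (fderiv ℝ f (x - h)) x := by
    have := (hd (x - h)).hasFDerivAt.comp x ((hasFDerivAt_id x).sub_const h)
    simpa [Function.comp_def] using this
  have h2 : HasFDerivAt (fun x => fderiv ℝ f x h) ((fderiv ℝ (fderiv ℝ f) x).flip h) x := by
    have := (hd' x).hasFDerivAt.clm_apply (hasFDerivAt_const h x)
    simpa using this
  have h3 : (fderiv ℝ (fderiv ℝ f) x).flip h = fderiv ℝ (fderiv ℝ f) x h := by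
    ext v
    have hs : IsSymmSndFDerivAt ℝ f x :=
      ContDiffAt.isSymmSndFDerivAt (n := ((⊤ : ℕ∞) : WithTop ℕ∞)) hf.contDiffAt
        (by simp only [minSmoothness_of_isRCLikeNormedField]
            exact WithTop.coe_le_coe.2 (le_top : (2 : ℕ∞) ≤ ⊤))
    exact hs v h
  rw [h3] at h2
  exact ((h1.sub (hd x).hasFDerivAt).add h2).fderiv

theorem ContDiff.fderiv_top {f : E → F} (hf : ContDiff ℝ (⊤ : ℕ∞) f) :
    ContDiff ℝ (⊤ : ℕ∞) (fderiv ℝ f) :=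
  hf.fderiv_right (m := ((⊤ : ℕ∞) : WithTop ℕ∞)) le_rfl

theorem exists_norm_fderiv_le {f : E → F} (hf : ContDiff ℝ (⊤ : ℕ∞) f)
    (hc : HasCompactSupport f) : ∃ C, ∀ x, ‖fderiv ℝ f x‖ ≤ C :=
  hf.fderiv_top.continuous.bounded_above_of_compact_support (hc.fderiv ℝ)

/-- A bound on `f''` makes `f'` Lipschitz, so on the ball of radius `‖h‖` about `x` it stays within
`C * ‖h‖` of `f' x`; the mean value inequality gives the second factor `‖h‖`. -/
theorem exists_norm_translationRemainder_le {f : E → F} (hf : ContDiff ℝ (⊤ : ℕ∞) f)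
    (hc : HasCompactSupport f) :
    ∃ C : ℝ, ∀ h x, ‖translationRemainder f h x‖ ≤ C * ‖h‖ ^ 2 := by
  have hf1 := hf.fderiv_top
  obtain ⟨C, hC⟩ := exists_norm_fderiv_le hf1 (hc.fderiv ℝ)
  refine ⟨C, fun h x => ?_⟩
  have h1 : ∀ z, ‖fderiv ℝ f z - fderiv ℝ f x‖ ≤ C * ‖z - x‖ := fun z =>
    Convex.norm_image_sub_le_of_norm_fderiv_le (𝕜 := ℝ) (s := Set.univ)
      (fun w _ => hf1.differentiable (by simp) w) (fun w _ => hC w) convex_univ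
      (Set.mem_univ _) (Set.mem_univ _)
  have hC0 : 0 ≤ C := (norm_nonneg _).trans (hC 0)
  have h2 := Convex.norm_image_sub_le_of_norm_hasFDerivWithin_le' (𝕜 := ℝ)
    (f := f) (C := C * ‖h‖) (s := Metric.closedBall x ‖h‖) (x := x) (y := x - h)
    (f' := fderiv ℝ f) (φ := fderiv ℝ f x)
    (fun z _ => ((hf.differentiable (by simp)) z).hasFDerivAt.hasFDerivWithinAt)
    (fun z hz => (h1 z).trans (by
      rw [Metric.mem_closedBall, dist_eq_norm] at hz
      gcongr))
    (convex_closedBall _ _) (by simp) (by simp)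
  have h3 : translationRemainder f h x = f (x - h) - f x - fderiv ℝ f x (x - h - x) := by
    simp [translationRemainder]
  rw [h3]
  refine h2.trans (le_of_eq ?_)
  simp
  ring

/-- The induction replaces `F` by `E →L[ℝ] F`, which stays in the same universe because `E` and `F`
share one. -/
theorem exists_norm_iteratedFDeriv_translationRemainder_le {E F : Type u} [NormedAddCommGroup E]
    [NormedSpace ℝ E] [NormedAddCommGroup F] [NormedSpace ℝ F] (i : ℕ) {f : E → F}
    (hf : ContDiff ℝ (⊤ : ℕ∞) f) (hc : HasCompactSupport f) :
    ∃ C : ℝ, ∀ h x, ‖iteratedFDeriv ℝ i (translationRemainder f h) x‖ ≤ C * ‖h‖ ^ 2 := by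
  induction i generalizing F with
  | zero =>
    simp only [norm_iteratedFDeriv_zero]
    exact exists_norm_translationRemainder_le hf hc
  | succ i ih =>
    obtain ⟨C, hC⟩ := ih hf.fderiv_top (hc.fderiv ℝ)
    refine ⟨C, fun h x => ?_⟩
    rw [← norm_iteratedFDeriv_fderiv, fderiv_translationRemainder hf]
    exact hC h x

end TaylorRemainder

/-! ### Differentiability of convolutions -/

namespace PDESystem

instance (n : ℕ) : ContinuousLinearMapClass (Distr n) ℝ (Test n) ℂ :=
  inferInstanceAs (ContinuousLinearMapClass
    𝓓'((⊤ : TopologicalSpace.Opens (EuclideanSpace ℝ (Fin n))), ℂ) ℝ (Test n) ℂ)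

/-- A distribution has finite order on every compact set. -/
theorem Distr.exists_norm_le {n : ℕ} (T : Distr n)
    (K : TopologicalSpace.Compacts (EuclideanSpace ℝ (Fin n))) :
    ∃ (s : Finset ℕ) (C : ℝ), 0 ≤ C ∧ ∀ ψ : Test n, tsupport ψ ⊆ K → ∀ B : ℝ, 0 ≤ B →
      (∀ i ∈ s, ∀ x, ‖iteratedFDeriv ℝ i ψ x‖ ≤ B) → ‖T ψ‖ ≤ C * B := by
  have hK : (K : Set (EuclideanSpace ℝ (Fin n))) ⊆
      ((⊤ : TopologicalSpace.Opens (EuclideanSpace ℝ (Fin n))) : Set _) := by simp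
  let L : 𝓓_{K}(EuclideanSpace ℝ (Fin n), ℝ) →ₗ[ℝ] ℂ :=
    { toFun := fun f => T (TestFunction.ofSupportedIn hK f)
      map_add' := fun f g => map_add T (TestFunction.ofSupportedIn hK f)
        (TestFunction.ofSupportedIn hK g)
      map_smul' := fun c f => map_smul T c (TestFunction.ofSupportedIn hK f) }
  have hL : Continuous L := (map_continuous T).comp (TestFunction.continuous_ofSupportedIn hK)
  obtain ⟨s, C, -, hC⟩ := Seminorm.bound_of_continuous
    (ContDiffMapSupportedIn.withSeminorms ℝ (EuclideanSpace ℝ (Fin n)) ℝ ⊤ K)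
    ((normSeminorm ℝ ℂ).comp L) (continuous_norm.comp hL)
  refine ⟨s, C, C.2, fun ψ hψ B hB h => ?_⟩
  let f : 𝓓_{K}(EuclideanSpace ℝ (Fin n), ℝ) :=
    ContDiffMapSupportedIn.of_support_subset ψ.contDiff (subset_closure.trans hψ)
  have h1 : ‖T ψ‖ ≤ (C • s.sup (ContDiffMapSupportedIn.seminorm ℝ
    (EuclideanSpace ℝ (Fin n)) ℝ ⊤ K)) f := hC f
  refine h1.trans ?_
  rw [_root_.smul_apply, NNReal.smul_def, smul_eq_mul]
  refine mul_le_mul_of_nonneg_left ?_ C.2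
  refine Seminorm.finset_sup_apply_le hB fun i hi => ?_
  rw [ContDiffMapSupportedIn.seminorm_top_le_iff ℝ hB]
  exact fun x _ => h i hi x

/-- The translate `x ↦ φ (x - y)` of a test function. -/
noncomputable def translate {n : ℕ} (y : EuclideanSpace ℝ (Fin n)) (φ : Test n) : Test n where
  toFun x := φ (x - y)
  contDiff' := φ.contDiff.comp (contDiff_id.sub contDiff_const)
  hasCompactSupport' := φ.hasCompactSupport.comp_homeomorph (Homeomorph.subRight y)
  tsupport_subset' := by simp

theorem translate_apply {n : ℕ} (y : EuclideanSpace ℝ (Fin n)) (φ : Test n)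
    (x : EuclideanSpace ℝ (Fin n)) : translate y φ x = φ (x - y) := rfl

theorem translate_zero {n : ℕ} (φ : Test n) : translate 0 φ = φ := by
  ext x
  simp [translate_apply]

theorem translate_add {n : ℕ} (y z : EuclideanSpace ℝ (Fin n)) (φ : Test n) :
    translate (y + z) φ = translate z (translate y φ) := by
  ext x
  simp only [translate_apply]
  congr 1
  abel

theorem tsupport_translate {n : ℕ} (y : EuclideanSpace ℝ (Fin n)) (φ : Test n) :
    tsupport (translate y φ) = (fun x => x - y) ⁻¹' tsupport φ :=
  tsupport_comp_eq_preimage φ (Homeomorph.subRight y)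

theorem testFunction_lineDeriv_apply {n : ℕ} (v : EuclideanSpace ℝ (Fin n)) (φ : Test n)
    (x : EuclideanSpace ℝ (Fin n)) : (∂_{v} φ : Test n) x = fderiv ℝ φ x v := by
  rw [TestFunction.lineDerivOp_eq_lineDerivCLM ℝ, TestFunction.lineDerivCLM_eq_fderivCLM,
    TestFunction.fderivCLM_apply_of_le φ (by simp)]

theorem Distr.lineDeriv_apply' {n : ℕ} (v : EuclideanSpace ℝ (Fin n)) (T : Distr n) (φ : Test n) :
    (∂_{v} T) φ = - T (∂_{v} φ) := by
  rw [Distr.lineDeriv_apply, map_neg]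

/-- The error of the linear approximation is `T` applied to a Taylor remainder. Its derivatives are
`O(‖h‖²)`, and `T` has finite order on a compact set containing all the supports. -/
theorem Distr.hasFDerivAt_translate_zero {n : ℕ} (T : Distr n) (φ : Test n)
    (L : EuclideanSpace ℝ (Fin n) →L[ℝ] ℂ) (hL : ∀ v, L v = (∂_{v} T) φ) :
    HasFDerivAt (fun y => T (translate y φ)) L 0 := by
  obtain ⟨r, hr⟩ := φ.hasCompactSupport.isCompact.isBounded.subset_closedBall 0
  -- The margin `1` accommodates all translations with `‖h‖ ≤ 1`.
  let K : TopologicalSpace.Compacts (EuclideanSpace ℝ (Fin n)) :=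
    ⟨Metric.closedBall 0 (r + 1), isCompact_closedBall _ _⟩
  obtain ⟨s, C, hC0, hC⟩ := T.exists_norm_le K
  choose D hD using fun i =>
    exists_norm_iteratedFDeriv_translationRemainder_le i φ.contDiff φ.hasCompactSupport
  have hb : ∀ h : EuclideanSpace ℝ (Fin n), ‖h‖ ≤ 1 →
      ‖T (translate h φ) - T φ - L h‖ ≤ C * ((∑ i ∈ s, |D i|) * ‖h‖ ^ 2) := by
    intro h hh
    have h1 : T (translate h φ) - T φ - L h = T (translate h φ - φ + ∂_{h} φ) := by
      rw [map_add, map_sub, hL, Distr.lineDeriv_apply']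
      ring
    have h2 : (translate h φ - φ + ∂_{h} φ : Test n) = translationRemainder φ h := by
      funext x
      simp [translationRemainder, translate_apply, testFunction_lineDeriv_apply]
    rw [h1]
    apply hC
    · rw [h2]
      refine closure_minimal ?_ Metric.isClosed_closedBall
      intro x hx
      by_contra hxK
      apply hx
      have hx' : r + 1 < ‖x‖ := by simpa [K] using hxK
      have h3 : ∀ z, r < ‖z‖ → z ∉ tsupport φ := fun z hz hzt => by
        have := hr hzt
        rw [mem_closedBall_zero_iff] at this
        linarith
      have h4 : x ∉ tsupport φ := h3 x (by linarith)
      have h5 : x - h ∉ tsupport φ := h3 _ (by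
        have := norm_sub_norm_le x h
        linarith)
      have h6 : fderiv ℝ φ x = 0 :=
        image_eq_zero_of_notMem_tsupport fun h => h4 (tsupport_fderiv_subset ℝ h)
      simp [translationRemainder, image_eq_zero_of_notMem_tsupport h4,
        image_eq_zero_of_notMem_tsupport h5, h6]
    · positivity
    · intro i hi x
      rw [h2]
      refine (hD i h x).trans ?_
      refine mul_le_mul_of_nonneg_right ((le_abs_self _).trans ?_) (by positivity)
      exact Finset.single_le_sum (f := fun i => |D i|) (fun _ _ => abs_nonneg _) hi
  rw [hasFDerivAt_iff_isLittleO_nhds_zero]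
  simp only [zero_add, translate_zero]
  refine Asymptotics.IsBigO.trans_isLittleO
    (g := fun h : EuclideanSpace ℝ (Fin n) => ‖h‖ ^ 2) ?_ ?_
  · refine Asymptotics.IsBigO.of_bound (C * ∑ i ∈ s, |D i|) ?_
    filter_upwards [Metric.closedBall_mem_nhds (0 : EuclideanSpace ℝ (Fin n)) one_pos] with h hh
    refine (hb h (by simpa using hh)).trans (le_of_eq ?_)
    rw [Real.norm_of_nonneg (by positivity)]
    ring
  · exact Asymptotics.isLittleO_norm_pow_id one_lt_two

/-- The derivative of `y ↦ T (φ (· - y))`. -/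
noncomputable def Distr.translateFDeriv {n : ℕ} (T : Distr n) (φ : Test n) :
    EuclideanSpace ℝ (Fin n) →L[ℝ] ℂ :=
  LinearMap.toContinuousLinearMap
    { toFun := fun v => (∂_{v} T) φ
      map_add' := fun v w => by
        simp only [Distr.lineDeriv_apply', LineDeriv.lineDerivOp_left_add, map_add]
        ring
      map_smul' := fun c v => by
        simp only [Distr.lineDeriv_apply', LineDeriv.lineDerivOp_left_smul, map_smul,
          RingHom.id_apply, smul_neg] }

theorem Distr.translateFDeriv_apply {n : ℕ} (T : Distr n) (φ : Test n)
    (v : EuclideanSpace ℝ (Fin n)) : T.translateFDeriv φ v = (∂_{v} T) φ := rfl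

/-- The convolution of a distribution with a (reflected) test function is differentiable. -/
theorem Distr.hasFDerivAt_translate {n : ℕ} (T : Distr n) (φ : Test n)
    (y : EuclideanSpace ℝ (Fin n)) :
    HasFDerivAt (fun y => T (translate y φ)) (T.translateFDeriv (translate y φ)) y := by
  have h1 := T.hasFDerivAt_translate_zero (translate y φ) _
    (T.translateFDeriv_apply (translate y φ))
  simp only [← translate_add] at h1
  have h2 : HasFDerivAt (fun z => z - y) (ContinuousLinearMap.id ℝ (EuclideanSpace ℝ (Fin n))) y :=
    (hasFDerivAt_id y).sub_const y
  have h3 := HasFDerivAt.comp (f := fun z => z - y) y (by simpa using h1) h2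
  simpa [Function.comp_def] using h3

end PDESystem

/-! ### Bounded support and the Fourier transform -/

namespace PDESystem

/-- A distribution that vanishes outside some ball. -/
def HasBoundedSupport {n : ℕ} (T : Distr n) : Prop :=
  ∃ r : ℝ, Distribution.IsVanishingOn T {x : EuclideanSpace ℝ (Fin n) | r < ‖x‖}

theorem isVanishingOn_lineDeriv {n : ℕ} {T : Distr n} {s : Set (EuclideanSpace ℝ (Fin n))}
    (h : Distribution.IsVanishingOn T s) (v : EuclideanSpace ℝ (Fin n)) :
    Distribution.IsVanishingOn (∂_{v} T : Distr n) s := by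
  intro φ hφ
  rw [Distr.lineDeriv_apply', neg_eq_zero]
  exact h (∂_{v} φ) ((tsupport_fderiv_apply_subset ℝ v).trans hφ)

theorem isVanishingOn_add {n : ℕ} {S T : Distr n} {s : Set (EuclideanSpace ℝ (Fin n))}
    (hS : Distribution.IsVanishingOn S s) (hT : Distribution.IsVanishingOn T s) :
    Distribution.IsVanishingOn (S + T) s := by
  intro φ hφ
  rw [Distr.add_apply, hS φ hφ, hT φ hφ, add_zero]

theorem isVanishingOn_zero {n : ℕ} {s : Set (EuclideanSpace ℝ (Fin n))} :
    Distribution.IsVanishingOn (0 : Distr n) s := fun _ _ => rfl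

theorem isVanishingOn_sum {n : ℕ} {ι : Type*} {t : Finset ι} {T : ι → Distr n}
    {s : Set (EuclideanSpace ℝ (Fin n))} (h : ∀ i, Distribution.IsVanishingOn (T i) s) :
    Distribution.IsVanishingOn (∑ i ∈ t, T i : Distr n) s := by
  classical
  induction t using Finset.induction_on with
  | empty => exact isVanishingOn_zero
  | insert i t hi ih =>
    rw [Finset.sum_insert hi]
    exact isVanishingOn_add (h i) ih

theorem isVanishingOn_smul {n : ℕ} {T : Distr n} {s : Set (EuclideanSpace ℝ (Fin n))}
    (h : Distribution.IsVanishingOn T s) (p : DiffOp n) :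
    Distribution.IsVanishingOn (p • T) s := by
  induction p using MvPolynomial.induction_on generalizing T with
  | C c =>
    intro φ hφ
    rw [C_smul, Distr.smul_apply, h φ hφ, mul_zero]
  | add p q hp hq =>
    rw [add_smul]
    exact isVanishingOn_add (hp h) (hq h)
  | mul_X p i hp =>
    rw [mul_smul, X_smul]
    exact hp (isVanishingOn_lineDeriv h _)

theorem HasBoundedSupport.lineDeriv {n : ℕ} {T : Distr n} (h : HasBoundedSupport T)
    (v : EuclideanSpace ℝ (Fin n)) : HasBoundedSupport (∂_{v} T : Distr n) :=
  let ⟨r, hr⟩ := h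
  ⟨r, isVanishingOn_lineDeriv hr v⟩

theorem HasBoundedSupport.smul {n : ℕ} {T : Distr n} (h : HasBoundedSupport T)
    (p : DiffOp n) : HasBoundedSupport (p • T) :=
  let ⟨r, hr⟩ := h
  ⟨r, isVanishingOn_smul hr p⟩

/-- The convolution `y ↦ T (φ (· - y))` of a distribution with a reflected test function. -/
noncomputable def Distr.conv {n : ℕ} (T : Distr n) (φ : Test n)
    (y : EuclideanSpace ℝ (Fin n)) : ℂ := T (translate y φ)

namespace Distr

variable {n : ℕ} (T : Distr n) (φ : Test n)

theorem fderiv_conv (y v : EuclideanSpace ℝ (Fin n)) :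
    fderiv ℝ (T.conv φ) y v = (∂_{v} T : Distr n).conv φ y := by
  rw [conv, ← translateFDeriv_apply]
  exact congrArg (· v) (T.hasFDerivAt_translate φ y).fderiv

theorem differentiable_conv : Differentiable ℝ (T.conv φ) := fun y =>
  (T.hasFDerivAt_translate φ y).differentiableAt

theorem continuous_conv : Continuous (T.conv φ) := (T.differentiable_conv φ).continuous

theorem continuous_fderiv_conv : Continuous (fderiv ℝ (T.conv φ)) := by
  rw [continuous_clm_apply]
  intro v
  simp only [fderiv_conv]
  exact continuous_conv _ φ

variable {T}

theorem hasCompactSupport_conv (hT : HasBoundedSupport T) : HasCompactSupport (T.conv φ) := by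
  obtain ⟨r, hr⟩ := hT
  obtain ⟨r', hr'⟩ := φ.hasCompactSupport.isCompact.isBounded.subset_closedBall 0
  refine HasCompactSupport.intro (isCompact_closedBall (0 : EuclideanSpace ℝ (Fin n)) (r + r'))
    fun y hy => hr _ fun x hx => ?_
  rw [tsupport_translate] at hx
  have h1 := hr' hx
  rw [mem_closedBall_zero_iff] at h1 hy
  have h2 := norm_sub_norm_le y (y - x)
  rw [sub_sub_cancel, norm_sub_rev] at h2
  simp only [Set.mem_ofPred_eq]
  linarith

theorem integrable_conv (hT : HasBoundedSupport T) : Integrable (T.conv φ) :=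
  (T.continuous_conv φ).integrable_of_hasCompactSupport (hasCompactSupport_conv φ hT)

theorem fourier_conv_lineDeriv (hT : HasBoundedSupport T) (v ξ : EuclideanSpace ℝ (Fin n)) :
    𝓕 ((∂_{v} T : Distr n).conv φ) ξ =
      (2 * Real.pi * Complex.I * inner ℝ v ξ) * 𝓕 (T.conv φ) ξ := by
  have hint : Integrable (fderiv ℝ (T.conv φ)) :=
    (T.continuous_fderiv_conv φ).integrable_of_hasCompactSupport
      ((hasCompactSupport_conv φ hT).fderiv ℝ)
  have h1 := congrFun (Real.fourier_fderiv (integrable_conv φ hT) (T.differentiable_conv φ) hint) ξ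
  have h2 : 𝓕 ((∂_{v} T : Distr n).conv φ) ξ = 𝓕 (fderiv ℝ (T.conv φ)) ξ v := by
    rw [Real.fourier_continuousLinearMap_apply hint]
    simp only [fderiv_conv]
  rw [h2, h1, VectorFourier.fourierSMulRight_apply]
  have h3 : (innerSL ℝ) ξ v = inner ℝ v ξ := by
    rw [innerSL_apply_apply, real_inner_comm]
  simp [h3, mul_assoc]

/-- Convolution commutes with derivatives, so `p(∂)` becomes multiplication by its symbol. -/
theorem fourier_conv_smul (hT : HasBoundedSupport T) (p : DiffOp n)
    (ξ : EuclideanSpace ℝ (Fin n)) :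
    𝓕 ((p • T).conv φ) ξ =
      MvPolynomial.eval (fun i => 2 * Real.pi * Complex.I * ξ i) p * 𝓕 (T.conv φ) ξ := by
  induction p using MvPolynomial.induction_on generalizing T with
  | C c =>
    have h : ((MvPolynomial.C c : DiffOp n) • T).conv φ = c • T.conv φ := by
      funext y
      rw [conv, C_smul]
      rfl
    rw [h, MvPolynomial.eval_C, ← smul_eq_mul]
    exact congrFun (VectorFourier.fourierIntegral_const_smul _ _ _ _ _) ξ
  | add p q hp hq =>
    have h : ((p + q) • T).conv φ = (p • T).conv φ + (q • T).conv φ := by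
      funext y
      rw [conv, add_smul]
      rfl
    have h2 : 𝓕 ((p • T).conv φ + (q • T).conv φ) = 𝓕 ((p • T).conv φ) + 𝓕 ((q • T).conv φ) :=
      VectorFourier.fourierIntegral_add Real.continuous_fourierChar (innerSL ℝ).continuous₂
        (integrable_conv φ (hT.smul p)) (integrable_conv φ (hT.smul q))
    rw [h, h2, Pi.add_apply, hp hT, hq hT, map_add, add_mul]
  | mul_X p i hp =>
    rw [mul_smul, X_smul, hp (hT.lineDeriv _), fourier_conv_lineDeriv φ hT, map_mul,
      MvPolynomial.eval_X, EuclideanSpace.inner_single_left]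
    simp
    ring

/-- The symbol of `p` times the continuous function `𝓕 (T.conv φ)` is zero. Were the latter nonzero
somewhere, `p` would vanish on a product of infinite sets and be zero. -/
theorem eq_zero_of_smul_eq_zero (hT : HasBoundedSupport T) {p : DiffOp n} (hp : p ≠ 0)
    (h : p • T = 0) : T = 0 := by
  have key : ∀ φ : Test n, 𝓕 (T.conv φ) = 0 := by
    intro φ
    by_contra hne
    obtain ⟨ξ, hξ⟩ := Function.ne_iff.1 hne
    have hcont : Continuous (𝓕 (T.conv φ)) :=
      VectorFourier.fourierIntegral_continuous Real.continuous_fourierChar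
        (innerSL ℝ).continuous₂ (integrable_conv φ hT)
    have hopen : IsOpen {x : Fin n → ℝ | 𝓕 (T.conv φ) (WithLp.toLp 2 x) ≠ 0} :=
      isOpen_ne_fun (hcont.comp (PiLp.continuous_toLp 2 _)) continuous_const
    obtain ⟨u, hu, hsub⟩ := isOpen_pi_iff'.1 hopen ξ.ofLp hξ
    have h2pi : (2 * Real.pi * Complex.I : ℂ) ≠ 0 := by
      simp [Real.pi_ne_zero]
    refine hp (MvPolynomial.funext_set
      (fun i => (fun t : ℝ => 2 * Real.pi * Complex.I * (t : ℂ)) '' u i) (fun i => ?_) ?_)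
    · refine Set.Infinite.image (fun s _ t _ hst => ?_)
        (infinite_of_mem_nhds _ ((hu i).1.mem_nhds (hu i).2))
      exact Complex.ofReal_injective (mul_left_cancel₀ h2pi hst)
    · intro x hx
      choose t ht htx using fun i => hx i (Set.mem_univ i)
      have hne' := hsub (show t ∈ Set.univ.pi u from fun i _ => ht i)
      have h1 := fourier_conv_smul φ hT p (WithLp.toLp 2 t)
      have h2 : (0 : Distr n).conv φ = 0 := rfl
      have h3 : 𝓕 (0 : EuclideanSpace ℝ (Fin n) → ℂ) (WithLp.toLp 2 t) = 0 := by
        rw [Real.fourier_eq]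
        simp
      rw [h, h2, h3, eq_comm, mul_eq_zero] at h1
      have h4 : x = fun i => 2 * Real.pi * Complex.I * (WithLp.toLp 2 t : EuclideanSpace ℝ (Fin n)) i :=
        funext fun i => (htx i).symm
      rw [map_zero, h4]
      exact h1.resolve_right hne'
  apply Distr.ext
  intro φ
  -- Fourier inversion at the origin recovers `T φ`.
  have h1 := (T.continuous_conv φ).fourierInv_fourier_eq (integrable_conv φ hT)
    (by rw [key φ]; exact integrable_zero _ _ _)
  have h2 := congrFun h1 0
  rw [key φ, conv, translate_zero] at h2
  rw [← h2, Real.fourierInv_eq]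
  simp
  rfl

end Distr

end PDESystem

/-! ### Unique continuation for exponential solutions -/

namespace PDESystem

/-- A distribution that vanishes locally is zero. -/
theorem Distr.eq_zero_of_forall_exists_isVanishingOn {n : ℕ} {T : Distr n}
    (h : ∀ x, ∃ U : Set (EuclideanSpace ℝ (Fin n)), IsOpen U ∧ x ∈ U ∧
      Distribution.IsVanishingOn T U) : T = 0 := by
  choose U hUo hxU hU using h
  obtain ⟨χ, hχ⟩ := SmoothPartitionOfUnity.exists_isSubordinate
    𝓘(ℝ, EuclideanSpace ℝ (Fin n)) isClosed_univ U hUo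
    (fun x _ => Set.mem_iUnion.2 ⟨x, hxU x⟩)
  apply Distr.ext
  intro φ
  have hfin := χ.locallyFinite.finite_nonempty_inter_compact φ.hasCompactSupport.isCompact
  let ψ : EuclideanSpace ℝ (Fin n) → Test n := fun i =>
    { toFun := fun x => χ i x * φ x
      contDiff' := (χ i).contMDiff.contDiff.mul φ.contDiff
      hasCompactSupport' := φ.hasCompactSupport.mul_left
      tsupport_subset' := by simp }
  have hψ : φ = ∑ i ∈ hfin.toFinset, ψ i := by
    ext x
    have h1 : (∑ i ∈ hfin.toFinset, ψ i) x = ∑ i ∈ hfin.toFinset, χ i x * φ x := by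
      rw [sum_apply]
      rfl
    rw [h1, ← Finset.sum_mul]
    by_cases hx : φ x = 0
    · rw [hx, mul_zero]
    · have h2 : ∑ᶠ i, χ i x = 1 := χ.sum_eq_one (Set.mem_univ x)
      rw [finsum_eq_sum_of_support_subset (s := hfin.toFinset)] at h2
      · rw [h2, one_mul]
      · intro i hi
        simp only [Set.Finite.coe_toFinset, Set.mem_ofPred_eq]
        exact ⟨x, hi, subset_tsupport _ hx⟩
  rw [hψ, map_sum]
  exact Finset.sum_eq_zero fun i _ => hU i (ψ i)
    ((tsupport_mul_subset_left (f := χ i) (g := φ)).trans (hχ i))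

/-- The directional derivatives of a common eigenvector of the partial derivatives. -/
theorem Distr.lineDeriv_eq_smul {n : ℕ} {T : Distr n} {c : Fin n → ℂ}
    (h : ∀ i, (MvPolynomial.X i - MvPolynomial.C (c i) : DiffOp n) • T = 0)
    (v : EuclideanSpace ℝ (Fin n)) : (∂_{v} T : Distr n) = (∑ i, (v i : ℂ) * c i) • T := by
  have h1 : ∀ i, (∂_{EuclideanSpace.single i (1 : ℝ)} T : Distr n) = c i • T := fun i => by
    rw [← X_smul, ← C_smul, ← sub_eq_zero, ← sub_smul, h i]
  apply Distr.ext
  intro φ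
  rw [← translateFDeriv_apply, Distr.smul_apply, Finset.sum_mul]
  conv_lhs => rw [← (EuclideanSpace.basisFun (Fin n) ℝ).sum_repr v, _root_.map_sum]
  refine Finset.sum_congr rfl fun i _ => ?_
  rw [_root_.map_smul, EuclideanSpace.basisFun_apply, translateFDeriv_apply, h1,
    Distr.smul_apply, EuclideanSpace.basisFun_repr, Complex.real_smul, mul_assoc]

/-- A common eigenvector of the partial derivatives that vanishes on a nonempty open set is zero. -/
theorem Distr.eq_zero_of_isVanishingOn_of_eigenvector {n : ℕ} {T : Distr n} {c : Fin n → ℂ}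
    (h : ∀ i, (MvPolynomial.X i - MvPolynomial.C (c i) : DiffOp n) • T = 0)
    {O : Set (EuclideanSpace ℝ (Fin n))} (hO : IsOpen O) (hne : O.Nonempty)
    (hT : Distribution.IsVanishingOn T O) : T = 0 := by
  have key : ∀ (v : EuclideanSpace ℝ (Fin n)) (φ : Test n), T (translate v φ) = 0 → T φ = 0 := by
    intro v φ h0
    let a := ∑ i, (v i : ℂ) * c i
    -- Along the line `t • v` the convolution solves `y' = a y`, so this product is constant; its
    -- values at `1` and `0` are compared.
    let g : ℝ → ℂ := fun t => T.conv φ (t • v) * Complex.exp (-(t * a))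
    have hg : ∀ t, HasDerivAt g 0 t := by
      intro t
      have h1 : HasDerivAt (fun t : ℝ => T.conv φ (t • v)) (a * T.conv φ (t • v)) t := by
        have h2 : HasDerivAt (fun t : ℝ => t • v) v t := by
          simpa using (hasDerivAt_id t).smul_const v
        have h3 := (T.hasFDerivAt_translate φ (t • v)).comp_hasDerivAt t h2
        rw [translateFDeriv_apply, Distr.lineDeriv_eq_smul h, Distr.smul_apply] at h3
        exact h3
      have h4 : HasDerivAt (fun t : ℝ => Complex.exp (-(t * a)))
          (Complex.exp (-(t * a)) * (-(1 * a))) t :=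
        (((Complex.ofRealCLM.hasDerivAt (x := t)).mul_const a).neg).cexp
      have h5 := h1.mul h4
      have h6 : a * T.conv φ (t • v) * Complex.exp (-(t * a)) +
          T.conv φ (t • v) * (Complex.exp (-(t * a)) * (-(1 * a))) = 0 := by ring
      rw [h6] at h5
      exact h5
    have h5 := is_const_of_deriv_eq_zero (fun t => (hg t).differentiableAt)
      (fun t => (hg t).deriv) 1 0
    simp only [g, conv, one_smul, h0, zero_mul, zero_smul, translate_zero, Complex.ofReal_zero,
      neg_zero, Complex.exp_zero, mul_one] at h5
    exact h5.symm
  obtain ⟨x₀, hx₀⟩ := hne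
  apply Distr.eq_zero_of_forall_exists_isVanishingOn
  intro x
  refine ⟨(fun z => z + (x₀ - x)) ⁻¹' O, hO.preimage (by fun_prop), by simpa using hx₀,
    fun φ hφ => key (x₀ - x) φ (hT _ ?_)⟩
  rw [tsupport_translate]
  intro z hz
  simpa using hφ hz

end PDESystem

/-! ### Controllability and torsion -/

namespace PDESystem

variable {n k : ℕ}

/-- The pairing of a tuple of elements of an `A`-module with tuples of operators. -/
noncomputable def pairing {F : Type*} [AddCommGroup F] [Module (DiffOp n) F] (f : Fin k → F) :
    (Fin k → DiffOp n) →ₗ[DiffOp n] F :=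
  Fintype.linearCombination (DiffOp n) f

theorem pairing_apply {F : Type*} [AddCommGroup F] [Module (DiffOp n) F] (f : Fin k → F)
    (p : Fin k → DiffOp n) : pairing f p = ∑ j, p j • f j :=
  rfl

theorem pairing_single {F : Type*} [AddCommGroup F] [Module (DiffOp n) F] (f : Fin k → F)
    (j : Fin k) : pairing f (Pi.single j (1 : DiffOp n)) = f j := by
  simp [pairing, Fintype.linearCombination_apply_single]

theorem pairing_comp_single {F : Type*} [AddCommGroup F] [Module (DiffOp n) F]
    (φ : (Fin k → DiffOp n) →ₗ[DiffOp n] F) : pairing (fun j => φ (Pi.single j 1)) = φ := by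
  apply LinearMap.pi_ext'
  intro j
  ext
  simp [pairing_single]

theorem mem_ker_iff {F : Submodule (DiffOp n) (Distr n)}
    {P : Submodule (DiffOp n) (Fin k → DiffOp n)} {f : Fin k → F} :
    f ∈ ker F P ↔ P ≤ LinearMap.ker (pairing f) := Iff.rfl

theorem coe_pairing {F : Submodule (DiffOp n) (Distr n)} (f : Fin k → F)
    (p : Fin k → DiffOp n) : (pairing f p : Distr n) = pairing (fun j => (f j : Distr n)) p := by
  simp [pairing_apply]

theorem isVanishingOn_pairing {f : Fin k → Distr n} {s : Set (EuclideanSpace ℝ (Fin n))}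
    (h : ∀ j, Distribution.IsVanishingOn (f j) s) (p : Fin k → DiffOp n) :
    Distribution.IsVanishingOn (pairing f p) s :=
  isVanishingOn_sum fun j => isVanishingOn_smul (h j) (p j)

/-- Differential operators preserve cutoffs. -/
theorem isCutoff_pairing {U V : Set (EuclideanSpace ℝ (Fin n))} {f g : Fin k → Distr n}
    (h : ∀ j, IsCutoff U V (f j) (g j)) (p : Fin k → DiffOp n) :
    IsCutoff U V (pairing f p) (pairing g p) := by
  choose O hO hUO hvan using fun j => (h j).1
  refine ⟨⟨⋂ j, O j, isOpen_iInter_of_finite hO, Set.subset_iInter hUO, ?_⟩,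
    isVanishingOn_pairing (fun j => (h j).2) p⟩
  have h1 : pairing g p - pairing f p = pairing (g - f) p := by
    simp [pairing_apply, smul_sub]
  rw [h1]
  refine isVanishingOn_pairing (fun j => ?_) p
  intro φ hφ
  exact hvan j φ (hφ.trans (Set.iInter_subset O j))

/-- The kernel of a system that is the kernel of a matrix of operators is controllable. -/
theorem isControllable_ker {F : Submodule (DiffOp n) (Distr n)} (hF : Module.Injective (DiffOp n) F)
    {P : Submodule (DiffOp n) (Fin k → DiffOp n)} {r : ℕ}
    {N : (Fin k → DiffOp n) →ₗ[DiffOp n] (Fin r → DiffOp n)} (hN : LinearMap.ker N = P) :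
    IsControllable F (ker F P) := by
  intro U V hUV f hf
  -- A solution is a homomorphism `Aᵏ/P → F`. As `N` embeds `Aᵏ/P` in `Aʳ`, injectivity extends it
  -- to `G`, whose values on the standard basis form a potential for `f`.
  let f' : ((Fin k → DiffOp n) ⧸ P) →ₗ[DiffOp n] F := P.liftQ (pairing f) (mem_ker_iff.1 hf)
  let N' : ((Fin k → DiffOp n) ⧸ P) →ₗ[DiffOp n] (Fin r → DiffOp n) := P.liftQ N hN.ge
  have hN' : Function.Injective N' := by
    rw [← LinearMap.ker_eq_bot]
    exact Submodule.ker_liftQ_eq_bot P N hN.ge hN.le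
  obtain ⟨G, hG⟩ := hF.out N' hN' f'
  have hfG : ∀ j, f j = pairing (fun i => G (Pi.single i 1)) (N (Pi.single j 1)) := fun j => by
    rw [pairing_comp_single]
    have h1 : G (N (Pi.single j 1)) = pairing f (Pi.single j 1) :=
      hG (Submodule.Quotient.mk (Pi.single j 1))
    rw [h1, pairing_single]
  choose g hg using fun i => hUV.2 (G (Pi.single i 1))
  refine ⟨fun j => pairing g (N (Pi.single j 1)), ?_, fun j => ?_⟩
  · rw [mem_ker_iff]
    have h2 : pairing (fun j => pairing g (N (Pi.single j 1))) = (pairing g).comp N :=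
      pairing_comp_single ((pairing g).comp N)
    rw [h2, ← hN]
    exact LinearMap.ker_le_ker_comp N (pairing g)
  · rw [hfG, coe_pairing, coe_pairing]
    exact isCutoff_pairing hg _

/-- If an injective cogenerator has cutoffs and the system is controllable, `Aᵏ / P` is torsion free:
a torsion element would give an exponential solution without cutoffs. -/
theorem isTorsionFree_of_isControllable {F : Submodule (DiffOp n) (Distr n)} (hcut : HasCutoffs F)
    (hF : Module.Injective (DiffOp n) F) (hcog : IsCogenerator F)
    {P : Submodule (DiffOp n) (Fin k → DiffOp n)} (hP : IsControllable F (ker F P)) :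
    Module.IsTorsionFree (DiffOp n) ((Fin k → DiffOp n) ⧸ P) := by
  rw [Submodule.isTorsionFree_quotient_iff]
  by_contra! htor
  obtain ⟨r, hr, p, hrp, hp⟩ := htor
  let Q := (Fin k → DiffOp n) ⧸ P
  let q : Q := Submodule.Quotient.mk p
  -- The annihilator of the torsion class `q` is proper, hence vanishes at some point `c`.
  let J : Ideal (DiffOp n) := LinearMap.ker (LinearMap.toSpanSingleton (DiffOp n) Q q)
  have hJ : J ≠ ⊤ := by
    rw [Ne, Ideal.eq_top_iff_one, LinearMap.mem_ker, LinearMap.toSpanSingleton_apply, one_smul,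
      Submodule.Quotient.mk_eq_zero]
    exact hp
  obtain ⟨m, hm, hJm⟩ := Ideal.exists_le_maximal J hJ
  obtain ⟨c, rfl⟩ := MvPolynomial.isMaximal_iff_eq_vanishingIdeal_singleton.1 hm
  set m := MvPolynomial.vanishingIdeal ℂ {c} with hm_def
  have : Nontrivial (DiffOp n ⧸ m) := Ideal.Quotient.nontrivial_iff.2 hm.ne_top
  obtain ⟨φ, hφ⟩ := hcog (DiffOp n ⧸ m)
  let e : F := φ 1
  have hφa : ∀ a : DiffOp n, φ (Ideal.Quotient.mk m a) = a • e := fun a => by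
    have h1 : Ideal.Quotient.mk m a = a • (1 : DiffOp n ⧸ m) := by
      rw [← map_one (Ideal.Quotient.mk m)]
      change _ = Ideal.Quotient.mk m (a * 1)
      rw [mul_one]
    rw [h1]
    exact φ.map_smul a 1
  have he : e ≠ 0 := by
    intro h0
    apply hφ
    apply LinearMap.ext
    intro x
    obtain ⟨a, rfl⟩ := Ideal.Quotient.mk_surjective x
    rw [hφa, h0, smul_zero]
    rfl
  have hme : ∀ a ∈ m, a • e = 0 := by
    intro a ha
    rw [← hφa, Ideal.Quotient.eq_zero_iff_mem.2 ha, map_zero]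
  let ι : (DiffOp n ⧸ J) →ₗ[DiffOp n] Q :=
    Submodule.liftQ J (LinearMap.toSpanSingleton (DiffOp n) Q q) le_rfl
  have hι : Function.Injective ι := by
    rw [← LinearMap.ker_eq_bot]
    exact Submodule.ker_liftQ_eq_bot J _ le_rfl le_rfl
  -- Since `J ≤ m` kills `e`, the assignment `q ↦ e` is well defined on the submodule generated by
  -- `q`.
  let ε : (DiffOp n ⧸ J) →ₗ[DiffOp n] F :=
    Submodule.liftQ J (LinearMap.toSpanSingleton (DiffOp n) F e) fun a ha => hme a (hJm ha)
  obtain ⟨Φ, hΦ⟩ := hF.out ι hι ε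
  have hΦq : Φ q = e := by
    have h1 : Φ ((1 : DiffOp n) • q) = (1 : DiffOp n) • e := hΦ (Submodule.Quotient.mk 1)
    rwa [one_smul, one_smul] at h1
  let f : Fin k → F := fun j => Φ (Submodule.Quotient.mk (Pi.single j 1))
  have hf : pairing f = Φ.comp P.mkQ := pairing_comp_single (Φ.comp P.mkQ)
  have hfker : f ∈ ker F P := by
    rw [mem_ker_iff, hf]
    intro x hx
    rw [LinearMap.mem_ker, LinearMap.comp_apply, Submodule.mkQ_apply,
      (Submodule.Quotient.mk_eq_zero P).2 hx, map_zero]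
  obtain ⟨U, ⟨x, hx⟩, -, hadm⟩ := hcut (Metric.ball 0 1) Metric.isBounded_ball
    ⟨0, by simp [Metric.isOpen_ball.interior_eq]⟩
  obtain ⟨g, hg, hfg⟩ := hP U _ hadm f hfker
  have hcutoff := isCutoff_pairing hfg p
  rw [← coe_pairing, ← coe_pairing, hf, LinearMap.comp_apply, Submodule.mkQ_apply] at hcutoff
  change IsCutoff U _ ((Φ q : F) : Distr n) _ at hcutoff
  rw [hΦq] at hcutoff
  obtain ⟨⟨O, hO, hUO, hvan⟩, hsupp⟩ := hcutoff
  -- It is killed by `r`, as `r • p ∈ P`, and it vanishes outside the unit ball.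
  have hg0 : (pairing g p : Distr n) = 0 := by
    refine Distr.eq_zero_of_smul_eq_zero ⟨1, fun ψ hψ => hsupp ψ (hψ.trans ?_)⟩ hr ?_
    · refine interior_maximal (fun y hy => ?_) (isOpen_lt continuous_const continuous_norm)
      simp only [Set.mem_compl_iff, mem_ball_zero_iff, not_lt]
      exact le_of_lt hy
    · rw [← Submodule.coe_smul, ← map_smul, LinearMap.mem_ker.1 (mem_ker_iff.1 hg hrp)]
      rfl
  apply he
  apply Subtype.ext
  refine Distr.eq_zero_of_isVanishingOn_of_eigenvector (c := c) (fun i => ?_) hO ⟨x, hUO hx⟩ ?_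
  · have h2 := hme (MvPolynomial.X i - MvPolynomial.C (c i)) (by
      simp [hm_def, MvPolynomial.mem_vanishingIdeal_iff])
    simpa using congrArg (Subtype.val) h2
  · intro ψ hψ
    have h3 := hvan ψ hψ
    rw [hg0, zero_sub] at h3
    have h4 : (-(e : Distr n)) ψ = -((e : Distr n) ψ) := rfl
    change (-(e : Distr n)) ψ = 0 at h3
    rwa [h4, neg_eq_zero] at h3

end PDESystem

/-! ### The generalized PBH test -/

open PDESystem in
-- The bound `dim ≤ n - 2` is written `dim + 2 ≤ n` to avoid truncated subtraction; for `n < 2` it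
-- forces dimension `⊥`.
theorem theorem2p2 (n k ℓ : ℕ)
    (P : Submodule (DiffOp n) (Fin k → DiffOp n))
    (M : Matrix (Fin ℓ) (Fin k) (DiffOp n))
    (hM : Submodule.span (DiffOp n) (Set.range fun i => M i) = P)
    (hne : cancellationIdeal M ≠ ⊥) :
    ℓ ≤ k ∧
    (Module.IsTorsionFree (DiffOp n) ((Fin k → DiffOp n) ⧸ P) ↔
      varietyDim (cancellationVariety M) + 2 ≤ (n : WithBot ℕ∞)) ∧
    (Module.IsTorsionFree (DiffOp n) ((Fin k → DiffOp n) ⧸ P) ↔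
      ∃ I : Ideal (DiffOp n),
        varietyDim (MvPolynomial.zeroLocus ℂ I) + 2 ≤ (n : WithBot ℕ∞) ∧
        ∀ x : Fin n → ℂ, x ∉ MvPolynomial.zeroLocus ℂ I →
          (M.map (MvPolynomial.eval x)).rank = ℓ) ∧
    (Module.IsTorsionFree (DiffOp n) ((Fin k → DiffOp n) ⧸ P) ↔
      ringKrullDim (DiffOp n ⧸ cancellationIdeal M) + 2 ≤ (n : WithBot ℕ∞)) ∧
    (∀ F : Submodule (DiffOp n) (Distr n),
      Module.Injective (DiffOp n) F →
      varietyDim (cancellationVariety M) + 2 ≤ (n : WithBot ℕ∞) →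
      IsControllable F (ker F P)) ∧
    (∀ F : Submodule (DiffOp n) (Distr n), HasCutoffs F →
      Module.Injective (DiffOp n) F → IsCogenerator F →
      IsControllable F (ker F P) →
      varietyDim (cancellationVariety M) + 2 ≤ (n : WithBot ℕ∞)) := by
  subst hM
  have hminor := exists_submatrix_det_ne_zero hne
  have htf := isTorsionFree_iff_ringKrullDim hne
  have hdim : varietyDim (cancellationVariety M) =
      ringKrullDim (DiffOp n ⧸ cancellationIdeal M) := varietyDim_zeroLocus _
  refine ⟨?_, by rw [hdim]; exact htf, ⟨fun h => ⟨cancellationIdeal M, ?_, fun x hx => ?_⟩, ?_⟩,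
    htf, fun F hF h => ?_, fun F hcut hF hcog h => ?_⟩
  · obtain ⟨c, -⟩ := hminor
    simpa using Fintype.card_le_of_injective c c.injective
  · rw [varietyDim_zeroLocus]
    exact htf.1 h
  · by_contra hr
    exact hx (mem_cancellationVariety.2 hr)
  · rintro ⟨I, hI, hrank⟩
    rw [htf, ← hdim]
    -- The rank drops at every point of the cancellation variety, so any admissible exceptional set
    -- contains it.
    have hsub : cancellationVariety M ⊆ MvPolynomial.zeroLocus ℂ I := by
      intro x hx
      by_contra hxI
      exact mem_cancellationVariety.1 hx (hrank x hxI)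
    exact le_trans (by gcongr; exact varietyDim_mono hsub) hI
  · rw [hdim, ← htf] at h
    obtain ⟨N, hN⟩ := exists_ker_eq_span_row hminor h
    exact isControllable_ker hF hN
  · rw [hdim, ← htf]
    exact isTorsionFree_of_isControllable hcut hF hcog h
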